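/- Let $A=\{1,\dots,m\}$ and $B=\{1,\dots,n\}$ be the nonempty finite action sets of Alice and Bob, let $\beta\in[0,1)$, and let $\mathbf r(a,b)\in[0,1-\beta]^K$ be Alice's vector loss when $a\in A$ and $b\in B$ are played. Write $\mathbf u\preceq\mathbf v$ if $u_k\le v_k$ for all $k$, and for $\mathcal S\subseteq\mathbb R^K$ let $\Lambda(\mathcal S)=\{\mathbf x\in\mathcal S:\ \forall\,\mathbf x'\in\mathcal S\setminus\{\mathbf x\}\ \exists\,k,\ x_k<x'_k\}$ be its lower Pareto frontier. Let $\mathcal F$ be the space of nonempty sets $\mathcal V\subseteq[0,1]^K$ no element of which is $\preceq$ another one and whose upset $\{\mathbf x\in[0,1]^K:\ \mathbf y\preceq\mathbf x\text{ for some }\mathbf y\in\mathcal V\}$ is closed and convex. For $\mathcal V\in\mathcal F$ let $\Phi(\mathcal V)=\Lambda(\Psi(\mathcal V))$, where $$\Psi(\mathcal V)=\Big\{\Big(\max_{b\in B}\sum_{a\in A}\alpha_a\big[r_k(a,b)+\beta R_k(a,b)\big]\Big)_{k=1}^K:\ \boldsymbol\alpha\in\Delta(A),\ \mathbf R(a,b)\in\mathcal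 V\ \ \forall a\in A,\,b\in B\Big\}.$$ In the infinitely repeated game, both players simultaneously choose actions $a_t,b_t$ at the stages $t=1,2,\dots$. Let $\Pi_A$ and $\Pi_B$ be the sets of adaptive randomized strategies of Alice and Bob, which map each history $(a_1,b_1,\dots,a_{t-1},b_{t-1})$ to a probability distribution on $A$, respectively on $B$. Put $R^\infty_k(\pi_A,\pi_B)=\mathrm E_{\pi_A,\pi_B}\big[\sum_{t\ge1}\beta^{t-1}r_k(a_t,b_t)\big]$ and $$\mathcal W^\infty=\Big\{\Big(\max_{\pi_B^k\in\Pi_B}R^\infty_k(\pi_A,\pi_B^k)\Big)_{k=1}^K:\ \pi_A\in\Pi_A\Big\},\qquad \mathcal V^\infty=\Lambda(\mathcal W^\infty).$$ Then the unique fixed point $\mathcal V^*\in\mathcal F$ of $\Phi$ is $\mathcal V^\infty$. That is, $\mathcal V^\infty\in\mathcal F$, $\Phi(\mathcal V^\infty)=\mathcal V^\infty$, and every $\mathcal V\in\mathcal F$ with $\Phi(\mathcal V)=\mathcal V$ equals $\mathcal V^\infty$. -/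

import Mathlib

namespace VectorGame

open MeasureTheory ProbabilityTheory

/-! ## Pareto frontiers in `[0,1]^K`

Vectors are functions `Fin K → ℝ`, with the componentwise order. -/

/-- The lower Pareto frontier `Λ(S)`: the points `x` of `S` such that every other point of `S`
is strictly larger than `x` in some component. -/
def paretoFrontier {K : ℕ} (S : Set (Fin K → ℝ)) : Set (Fin K → ℝ) :=
  {x | x ∈ S ∧ ∀ x' ∈ S \ {x}, ∃ k, x k < x' k}

/-- The upset in `[0,1]^K`. -/
def upset {K : ℕ} (V : Set (Fin K → ℝ)) : Set (Fin K → ℝ) :=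
  {x | x ∈ Set.Icc 0 1 ∧ ∃ y ∈ V, y ≤ x}

/-- The space `𝓕` of (nonempty) Pareto frontiers in `[0,1]^K` with closed and convex upset. -/
def frontierSpace (K : ℕ) : Set (Set (Fin K → ℝ)) :=
  {V | V.Nonempty ∧ V ⊆ Set.Icc 0 1 ∧ (∀ u ∈ V, ∀ v ∈ V, u ≤ v → u = v) ∧
    IsClosed (upset V) ∧ Convex ℝ (upset V)}

/-! ## The dynamic programming operator

`A = Fin m` and `B = Fin n` are the action sets of Alice and Bob, `r a b k` is the `k`-th
component of the loss at `(a, b)`, and `β` is the discount factor. -/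

/-- The operator `Ψ`: simultaneous upper bounds obtained from a mixed action `α` and
continuation vectors `R a b ∈ S`; `u k` is the maximum over `b`. -/
def preOperator {m n K : ℕ} (β : ℝ) (r : Fin m → Fin n → Fin K → ℝ) (S : Set (Fin K → ℝ)) :
    Set (Fin K → ℝ) :=
  {u | ∃ α ∈ stdSimplex ℝ (Fin m), ∃ R : Fin m → Fin n → Fin K → ℝ,
    (∀ a b, R a b ∈ S) ∧
    ∀ k, IsGreatest (Set.range fun b : Fin n => ∑ a, α a * (r a b k + β * R a b k)) (u k)}

/-- The dynamic programming operator `Φ = Λ ∘ Ψ`. -/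
def dpOperator {m n K : ℕ} (β : ℝ) (r : Fin m → Fin n → Fin K → ℝ) (V : Set (Fin K → ℝ)) :
    Set (Fin K → ℝ) :=
  paretoFrontier (preOperator β r V)

/-! ## The infinitely repeated game

Stages are numbered `0, 1, 2, …`. -/

/-- The history before stage `t`: the pairs of actions played at the stages `0, …, t - 1`. -/
abbrev History (m n t : ℕ) : Type := Fin t → Fin m × Fin n

/-- Adaptive randomized strategies of Alice. -/
abbrev AliceStrategy (m n : ℕ) : Type := (t : ℕ) → History m n t → stdSimplex ℝ (Fin m)

/-- Adaptive randomized strategies of Bob. -/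
abbrev BobStrategy (m n : ℕ) : Type := (t : ℕ) → History m n t → stdSimplex ℝ (Fin n)

/-- The probability measure on `Fin N` with weights `p`. -/
noncomputable def simplexMeasure {N : ℕ} (p : stdSimplex ℝ (Fin N)) : Measure (Fin N) :=
  ∑ i, ENNReal.ofReal (p i) • Measure.dirac i

instance simplexMeasure_isProbabilityMeasure {N : ℕ} (p : stdSimplex ℝ (Fin N)) :
    IsProbabilityMeasure (simplexMeasure p) := by
  constructor
  have h : ∑ i, ENNReal.ofReal (p i) = 1 := by
    have h1 : ∑ i, p i = 1 := p.2.2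
    rw [← ENNReal.ofReal_sum_of_nonneg (fun i _ => show 0 ≤ p i from p.2.1 i), h1,
      ENNReal.ofReal_one]
  simpa [simplexMeasure] using h

/-- The law of the pair of actions played at stage `t` given the history: Alice and Bob
randomize independently. -/
noncomputable def stageLaw {m n : ℕ} (πA : AliceStrategy m n) (πB : BobStrategy m n) (t : ℕ)
    (h : History m n t) : Measure (Fin m × Fin n) :=
  (simplexMeasure (πA t h)).prod (simplexMeasure (πB t h))

instance stageLaw_isProbabilityMeasure {m n : ℕ} (πA : AliceStrategy m n)
    (πB : BobStrategy m n) (t : ℕ) (h : History m n t) :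
    IsProbabilityMeasure (stageLaw πA πB t h) := by
  unfold stageLaw; infer_instance

/-- The transition kernel from the play at the stages `0, …, t` to the pair of actions at
stage `t + 1`. -/
noncomputable def stageKernel {m n : ℕ} (πA : AliceStrategy m n) (πB : BobStrategy m n) (t : ℕ) :
    Kernel (Finset.Iic t → Fin m × Fin n) (Fin m × Fin n) where
  toFun x := stageLaw πA πB (t + 1)
    fun i => x ⟨i, Finset.mem_Iic.mpr (Nat.lt_succ_iff.mp i.isLt)⟩
  measurable' := Measurable.of_discrete

instance stageKernel_isMarkovKernel {m n : ℕ} (πA : AliceStrategy m n) (πB : BobStrategy m n)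
    (t : ℕ) : IsMarkovKernel (stageKernel πA πB t) :=
  ⟨fun _ => stageLaw_isProbabilityMeasure πA πB (t + 1) _⟩

/-- The law of the infinite play under a pair of strategies (Ionescu-Tulcea). -/
noncomputable def playMeasure {m n : ℕ} (πA : AliceStrategy m n) (πB : BobStrategy m n) :
    Measure (ℕ → Fin m × Fin n) :=
  Kernel.trajMeasure (X := fun _ => Fin m × Fin n) (stageLaw πA πB 0 Fin.elim0)
    (stageKernel πA πB)

/-- The expected total discounted loss on component `k` in the infinitely repeated game. -/
noncomputable def expectedLoss {m n K : ℕ} (β : ℝ) (r : Fin m → Fin n → Fin K → ℝ)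
    (πA : AliceStrategy m n) (πB : BobStrategy m n) (k : Fin K) : ℝ :=
  ∫ ω, ∑' t : ℕ, β ^ t * r (ω t).1 (ω t).2 k ∂(playMeasure πA πB)

/-- The set `𝓦^∞` of simultaneous worst-case upper bounds: `w` belongs to it if for some strategy
of Alice each `w k` is the maximum, over Bob's strategies, of the expected loss on component `k`
(the maximizing strategy of Bob may depend on `k`). -/
def guarantees {m n K : ℕ} (β : ℝ) (r : Fin m → Fin n → Fin K → ℝ) : Set (Fin K → ℝ) :=
  {w | ∃ πA : AliceStrategy m n, ∀ k,
    IsGreatest (Set.range fun πB : BobStrategy m n => expectedLoss β r πA πB k) (w k)}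

/-- The set `𝓥^∞ = Λ(𝓦^∞)`. -/
def optimalFrontier {m n K : ℕ} (β : ℝ) (r : Fin m → Fin n → Fin K → ℝ) : Set (Fin K → ℝ) :=
  paretoFrontier (guarantees β r)

end VectorGame

namespace VectorGame

open MeasureTheory ProbabilityTheory

/-! ## Histories and continuation strategies -/

/-! A frontier and its closed upset determine each other (`paretoFrontier_upset`,
`upset_paretoFrontier`). On upsets, `dpOperator` becomes the monotone operator `stepUpset`, and
`guarantees` becomes `secured`. It remains to show that `secured` is the only nonempty closed fixed
point of `stepUpset`.

The tool is coinduction (`subset_secured`): if `U ⊆ stepUpset β r U`, Alice secures every point of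
`U` by keeping a promised vector as her state. Conversely, the continuations of a securing strategy
secure vectors of best-response losses (`secured_subset_stepUpset`). So `secured` is the greatest
fixed point; applying coinduction to its closure and convex hull shows that it is closed and convex.

For uniqueness (`eq_secured_of_stepUpset_eq`), discounting shrinks errors: a nonempty closed fixed
point contains each secured point raised by `β ^ t` and capped at 1, for all `t`, hence the point
itself. -/

/-- The strategy that a player follows after the first stage, if `x` was played there. -/
def continuation {m n : ℕ} {S : Type*} (σ : (t : ℕ) → History m n t → S) (x : Fin m × Fin n) :
    (t : ℕ) → History m n t → S :=
  fun t h => σ (t + 1) (Fin.cons x h)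

/-- The strategy that starts with `s` and follows `σ x` if `x` was played at the first stage. -/
def prepend {m n : ℕ} {S : Type*} (s : S) (σ : Fin m × Fin n → (t : ℕ) → History m n t → S) :
    (t : ℕ) → History m n t → S
  | 0, _ => s
  | t + 1, h => σ (h 0) t (Fin.tail h)

/-- The probability that `x` is played at stage `t` after the history `h`. -/
def stageProb {m n : ℕ} (σ : AliceStrategy m n) (τ : BobStrategy m n) (t : ℕ)
    (h : History m n t) (x : Fin m × Fin n) : ℝ :=
  σ t h x.1 * τ t h x.2

/-- The probability of the history `h`. -/
def pathProb {m n : ℕ} (σ : AliceStrategy m n) (τ : BobStrategy m n) :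
    (t : ℕ) → History m n t → ℝ
  | 0, _ => 1
  | t + 1, h => pathProb σ τ t (Fin.init h) * stageProb σ τ t (Fin.init h) (h (Fin.last t))

/-- `pathProb` recurses on the last stage; dynamic programming needs the first stage split off
instead. -/
lemma pathProb_cons {m n : ℕ} (σ : AliceStrategy m n) (τ : BobStrategy m n)
    (x : Fin m × Fin n) (t : ℕ) (h : History m n t) :
    pathProb σ τ (t + 1) (Fin.cons x h) =
      stageProb σ τ 0 Fin.elim0 x * pathProb (continuation σ x) (continuation τ x) t h := by
  induction t with
  | zero =>
    have : (Fin.init (Fin.cons x h : History m n 1)) = Fin.elim0 := Subsingleton.elim _ _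
    simp [pathProb, this]
  | succ t ih =>
    have h1 : (Fin.init (Fin.cons x h : History m n (t + 2))) = Fin.cons x (Fin.init h) := by
      funext i
      refine Fin.cases ?_ (fun j => ?_) i <;> simp [Fin.init]
    have h2 : (Fin.cons x h : History m n (t + 2)) (Fin.last (t + 1)) = h (Fin.last t) := by
      rw [← Fin.succ_last, Fin.cons_succ]
    rw [pathProb, h1, h2, ih, pathProb, mul_assoc]
    rfl

lemma stageLaw_singleton {m n : ℕ} (σ : AliceStrategy m n) (τ : BobStrategy m n) (t : ℕ)
    (h : History m n t) (x : Fin m × Fin n) :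
    (stageLaw σ τ t h).real {x} = stageProb σ τ t h x := by
  have key : ∀ {N : ℕ} (p : stdSimplex ℝ (Fin N)) (i : Fin N),
      (simplexMeasure p).real {i} = p i := by
    intro N p i
    have : simplexMeasure p {i} = ENNReal.ofReal (p i) := by
      rw [simplexMeasure, Measure.finsetSum_apply, Finset.sum_eq_single i] <;>
        simp +contextual
    rw [measureReal_def, this]
    exact ENNReal.toReal_ofReal (p.2.1 i)
  obtain ⟨a, b⟩ := x
  rw [← Set.singleton_prod_singleton, stageLaw, measureReal_prod_prod, key, key]
  rfl

/-! ### Finite marginals of the law of the play -/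

instance {m n : ℕ} (σ : AliceStrategy m n) (τ : BobStrategy m n) :
    IsProbabilityMeasure (playMeasure σ τ) := by
  unfold playMeasure; infer_instance

lemma playMeasure_map_zero {m n : ℕ} (σ : AliceStrategy m n) (τ : BobStrategy m n) :
    (playMeasure σ τ).map (fun ω => ω 0) = stageLaw σ τ 0 Fin.elim0 := by
  have h1 : (fun ω : ℕ → Fin m × Fin n => ω 0) =
      (fun x : Finset.Iic 0 → Fin m × Fin n => x ⟨0, by simp⟩) ∘ Preorder.frestrictLe 0 := rfl
  rw [h1, ← Measure.map_map (by fun_prop) (by fun_prop), playMeasure, Kernel.trajMeasure,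
    Measure.map_comp _ _ (by fun_prop), Kernel.traj_map_frestrictLe, Kernel.partialTraj_self,
    Measure.id_comp, Measure.map_map (by fun_prop) (by fun_prop)]
  exact Measure.map_id

/-- Reduces the Ionescu-Tulcea measure to explicit finite products. -/
lemma playMeasure_path {m n : ℕ} (σ : AliceStrategy m n) (τ : BobStrategy m n) (t : ℕ)
    (h : History m n (t + 1)) :
    (playMeasure σ τ).real {ω | (fun i : Fin (t + 1) => ω i) = h} = pathProb σ τ (t + 1) h := by
  induction t with
  | zero =>
    have hs : {ω : ℕ → Fin m × Fin n | (fun i : Fin 1 => ω i) = h} =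
        (fun ω => ω 0) ⁻¹' {h 0} := by
      ext ω
      simp [funext_iff]
    have h0 : (Fin.init h) = Fin.elim0 := Subsingleton.elim _ _
    rw [hs, ← map_measureReal_apply (by fun_prop) (measurableSet_singleton _),
      playMeasure_map_zero, stageLaw_singleton]
    simp [pathProb, h0]
  | succ t ih =>
    let g : Finset.Iic t → Fin m × Fin n := fun i => h ⟨i, by
      have := Finset.mem_Iic.mp i.2
      omega⟩
    have hs : {ω : ℕ → Fin m × Fin n | (fun i : Fin (t + 2) => ω i) = h} =
        (fun ω : ℕ → Fin m × Fin n => (Preorder.frestrictLe t ω, ω (t + 1))) ⁻¹'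
          ({g} ×ˢ {h (Fin.last _)}) := by
      ext ω
      simp only [Set.mem_ofPred_eq, Set.mem_preimage, Set.mem_prod, Set.mem_singleton_iff,
        funext_iff]
      constructor
      · intro H
        exact ⟨fun i => H ⟨i, _⟩, H (Fin.last _)⟩
      · rintro ⟨H1, H2⟩ i
        refine Fin.lastCases ?_ (fun j => ?_) i
        · exact H2
        · exact H1 ⟨j, by simp; omega⟩
    have hg : {ω : ℕ → Fin m × Fin n | (fun i : Fin (t + 1) => ω i) = Fin.init h} =
        (Preorder.frestrictLe (π := fun _ => Fin m × Fin n) t) ⁻¹' {g} := by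
      ext ω
      simp only [Set.mem_ofPred_eq, Set.mem_preimage, Set.mem_singleton_iff, funext_iff]
      constructor
      · intro H i
        exact H ⟨i, by
          have := Finset.mem_Iic.mp i.2
          omega⟩
      · intro H j
        exact H ⟨j, by simp; omega⟩
    -- The joint law of the play up to `t` and the next pair is the composition product with the
    -- stage kernel.
    have hc := Kernel.map_frestrictLe_trajMeasure_compProd_eq_map_trajMeasure
      (X := fun _ => Fin m × Fin n) (μ₀ := stageLaw σ τ 0 Fin.elim0) (κ := stageKernel σ τ)
      (a := t)
    rw [show pathProb σ τ (t + 1 + 1) h = pathProb σ τ (t + 1) (Fin.init h) *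
      stageProb σ τ (t + 1) (Fin.init h) (h (Fin.last _)) from rfl, ← ih, hg, hs]
    simp only [measureReal_def]
    rw [← Measure.map_apply (by fun_prop) (DiscreteMeasurableSpace.forall_measurableSet _),
      playMeasure, ← hc, Measure.compProd_apply_prod (measurableSet_singleton _)
        (measurableSet_singleton _), lintegral_singleton, ENNReal.toReal_mul, mul_comm,
      Measure.map_apply (by fun_prop) (measurableSet_singleton _)]
    congr 1
    exact stageLaw_singleton σ τ (t + 1) (Fin.init h) (h (Fin.last _))

/-- The expectation of `f` at the pair of actions played at stage `t`. -/
def stageMean {m n : ℕ} (σ : AliceStrategy m n) (τ : BobStrategy m n) (f : Fin m × Fin n → ℝ)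
    (t : ℕ) : ℝ :=
  ∑ h : History m n (t + 1), pathProb σ τ (t + 1) h * f (h (Fin.last t))

lemma integral_play {m n : ℕ} (σ : AliceStrategy m n) (τ : BobStrategy m n)
    (f : Fin m × Fin n → ℝ) (t : ℕ) :
    ∫ ω, f (ω t) ∂(playMeasure σ τ) = stageMean σ τ f t := by
  have hm : Measurable fun (ω : ℕ → Fin m × Fin n) (i : Fin (t + 1)) => ω i := by fun_prop
  have h1 : ∫ ω, f (ω t) ∂(playMeasure σ τ) = ∫ h : History m n (t + 1), f (h (Fin.last t))
      ∂((playMeasure σ τ).map fun (ω : ℕ → Fin m × Fin n) (i : Fin (t + 1)) => ω i) := by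
    rw [integral_map hm.aemeasurable (Measurable.of_discrete).aestronglyMeasurable]
    rfl
  have : IsProbabilityMeasure ((playMeasure σ τ).map
      fun (ω : ℕ → Fin m × Fin n) (i : Fin (t + 1)) => ω i) :=
    Measure.isProbabilityMeasure_map hm.aemeasurable
  rw [h1, integral_fintype (Integrable.of_finite), stageMean]
  refine Finset.sum_congr rfl fun h _ => ?_
  rw [map_measureReal_apply hm (measurableSet_singleton _), ← playMeasure_path, smul_eq_mul]
  rfl

lemma stageMean_zero {m n : ℕ} (σ : AliceStrategy m n) (τ : BobStrategy m n)
    (f : Fin m × Fin n → ℝ) :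
    stageMean σ τ f 0 = ∑ x, stageProb σ τ 0 Fin.elim0 x * f x := by
  rw [stageMean]
  refine Fintype.sum_equiv (Equiv.funUnique (Fin 1) _) _ _ fun h => ?_
  have h0 : (Fin.init h) = Fin.elim0 := Subsingleton.elim _ _
  simp [pathProb, h0]

lemma stageMean_succ {m n : ℕ} (σ : AliceStrategy m n) (τ : BobStrategy m n)
    (f : Fin m × Fin n → ℝ) (t : ℕ) :
    stageMean σ τ f (t + 1) = ∑ x, stageProb σ τ 0 Fin.elim0 x *
      stageMean (continuation σ x) (continuation τ x) f t := by
  rw [stageMean, ← Fintype.sum_equiv (Fin.consEquiv fun _ : Fin (t + 2) => Fin m × Fin n)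
    (fun p => pathProb σ τ (t + 2) (Fin.cons p.1 p.2) *
      f ((Fin.cons p.1 p.2 : History m n (t + 2)) (Fin.last _))) _ (fun _ => rfl),
    Fintype.sum_prod_type]
  refine Finset.sum_congr rfl fun x _ => ?_
  rw [stageMean, Finset.mul_sum]
  refine Finset.sum_congr rfl fun h _ => ?_
  rw [pathProb_cons, ← Fin.succ_last, Fin.cons_succ, mul_assoc]

/-! ## The discounted loss -/

section Loss

variable {m n K : ℕ} {β : ℝ} {r : Fin m → Fin n → Fin K → ℝ}

/-- Bounding the integral avoids a separate proof that path probabilities sum to 1. -/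
lemma stageMean_mem (hr : ∀ a b k, r a b k ∈ Set.Icc (0 : ℝ) (1 - β))
    (σ : AliceStrategy m n) (τ : BobStrategy m n) (k : Fin K) (t : ℕ) :
    stageMean σ τ (fun x => r x.1 x.2 k) t ∈ Set.Icc (0 : ℝ) (1 - β) := by
  rw [← integral_play σ τ (fun x => r x.1 x.2 k)]
  refine ⟨integral_nonneg fun ω => (hr _ _ _).1, ?_⟩
  have h := norm_integral_le_of_norm_le_const (μ := playMeasure σ τ)
    (f := fun ω : ℕ → Fin m × Fin n => r (ω t).1 (ω t).2 k) (C := 1 - β)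
    (Filter.Eventually.of_forall fun ω => by
      rw [Real.norm_eq_abs, abs_of_nonneg (hr _ _ _).1]; exact (hr _ _ _).2)
  simpa using (le_abs_self _).trans h

lemma summable_discounted (hβ : β ∈ Set.Ico (0 : ℝ) 1) {f : ℕ → ℝ}
    (hf : ∀ t, f t ∈ Set.Icc (0 : ℝ) (1 - β)) : Summable fun t => β ^ t * f t :=
  Summable.of_nonneg_of_le (fun t => mul_nonneg (pow_nonneg hβ.1 t) (hf t).1)
    (fun t => mul_le_mul_of_nonneg_left (hf t).2 (pow_nonneg hβ.1 t))
    ((summable_geometric_of_lt_one hβ.1 hβ.2).mul_right (1 - β))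

lemma expectedLoss_eq_tsum (hβ : β ∈ Set.Ico (0 : ℝ) 1)
    (hr : ∀ a b k, r a b k ∈ Set.Icc (0 : ℝ) (1 - β))
    (σ : AliceStrategy m n) (τ : BobStrategy m n) (k : Fin K) :
    expectedLoss β r σ τ k = ∑' t : ℕ, β ^ t * stageMean σ τ (fun x => r x.1 x.2 k) t := by
  have hmeas : ∀ t : ℕ, Measurable fun ω : ℕ → Fin m × Fin n => β ^ t * r (ω t).1 (ω t).2 k :=
    fun t => (Measurable.of_discrete (f := fun x : Fin m × Fin n => β ^ t * r x.1 x.2 k)).comp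
      (measurable_pi_apply t)
  have hnorm : ∀ (t : ℕ) (ω : ℕ → Fin m × Fin n),
      ‖β ^ t * r (ω t).1 (ω t).2 k‖ = β ^ t * r (ω t).1 (ω t).2 k := fun t ω => by
    rw [Real.norm_eq_abs, abs_of_nonneg (mul_nonneg (pow_nonneg hβ.1 t) (hr _ _ _).1)]
  have hint : ∀ t : ℕ, ∫ ω, β ^ t * r (ω t).1 (ω t).2 k ∂(playMeasure σ τ) =
      β ^ t * stageMean σ τ (fun x => r x.1 x.2 k) t := fun t => by
    rw [integral_const_mul, ← integral_play σ τ (fun x => r x.1 x.2 k)]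
  rw [expectedLoss, ← integral_tsum_of_summable_integral_norm]
  · exact tsum_congr hint
  · intro t
    refine Integrable.of_bound (hmeas t).aestronglyMeasurable (β ^ t * (1 - β))
      (Filter.Eventually.of_forall fun ω => ?_)
    rw [hnorm]
    exact mul_le_mul_of_nonneg_left (hr _ _ _).2 (pow_nonneg hβ.1 t)
  · simp_rw [hnorm, hint]
    exact summable_discounted hβ fun t => stageMean_mem hr σ τ k t

lemma expectedLoss_mem (hβ : β ∈ Set.Ico (0 : ℝ) 1)
    (hr : ∀ a b k, r a b k ∈ Set.Icc (0 : ℝ) (1 - β))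
    (σ : AliceStrategy m n) (τ : BobStrategy m n) (k : Fin K) :
    expectedLoss β r σ τ k ∈ Set.Icc (0 : ℝ) 1 := by
  have hm := fun t => stageMean_mem hr σ τ k t
  rw [expectedLoss_eq_tsum hβ hr]
  refine ⟨tsum_nonneg fun t => mul_nonneg (pow_nonneg hβ.1 t) (hm t).1, ?_⟩
  have hs := (summable_geometric_of_lt_one hβ.1 hβ.2).mul_right (1 - β)
  refine ((summable_discounted hβ hm).tsum_le_tsum
    (fun t => mul_le_mul_of_nonneg_left (hm t).2 (pow_nonneg hβ.1 t)) hs).trans ?_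
  rw [tsum_mul_right, tsum_geometric_of_lt_one hβ.1 hβ.2, inv_mul_cancel₀]
  linarith [hβ.2]

/-- First-step decomposition of the discounted loss. -/
lemma expectedLoss_eq_sum (hβ : β ∈ Set.Ico (0 : ℝ) 1)
    (hr : ∀ a b k, r a b k ∈ Set.Icc (0 : ℝ) (1 - β))
    (σ : AliceStrategy m n) (τ : BobStrategy m n) (k : Fin K) :
    expectedLoss β r σ τ k = ∑ b, τ 0 Fin.elim0 b * ∑ a, σ 0 Fin.elim0 a *
      (r a b k + β * expectedLoss β r (continuation σ (a, b)) (continuation τ (a, b)) k) := by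
  have hm := fun (σ : AliceStrategy m n) τ t => stageMean_mem hr σ τ k t
  have hs := fun (σ : AliceStrategy m n) τ => summable_discounted hβ (hm σ τ)
  have h1 : ∀ t, β ^ (t + 1) * stageMean σ τ (fun x => r x.1 x.2 k) (t + 1) =
      ∑ x : Fin m × Fin n, stageProb σ τ 0 Fin.elim0 x * (β * (β ^ t *
        stageMean (continuation σ x) (continuation τ x) (fun x => r x.1 x.2 k) t)) := fun t => by
    rw [stageMean_succ, Finset.mul_sum]
    exact Finset.sum_congr rfl fun x _ => by ring
  rw [expectedLoss_eq_tsum hβ hr, (hs σ τ).tsum_eq_zero_add]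
  simp_rw [h1]
  rw [Summable.tsum_finsetSum fun x _ => ((hs _ _).mul_left β).mul_left _]
  simp_rw [tsum_mul_left, ← expectedLoss_eq_tsum hβ hr]
  rw [stageMean_zero, pow_zero, one_mul, ← Finset.sum_add_distrib, Fintype.sum_prod_type_right]
  refine Finset.sum_congr rfl fun b _ => ?_
  rw [Finset.mul_sum]
  exact Finset.sum_congr rfl fun a _ => by simp only [stageProb]; ring

/-- In the product topology each stage mean is a polynomial in finitely many coordinates of `τ`; the
geometric bound makes the series converge uniformly. -/
lemma continuous_expectedLoss (hβ : β ∈ Set.Ico (0 : ℝ) 1)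
    (hr : ∀ a b k, r a b k ∈ Set.Icc (0 : ℝ) (1 - β)) (σ : AliceStrategy m n) (k : Fin K) :
    Continuous fun τ : BobStrategy m n => expectedLoss β r σ τ k := by
  have hstage : ∀ t h x, Continuous fun τ : BobStrategy m n => stageProb σ τ t h x := by
    intro t h x
    refine continuous_const.mul ?_
    exact (continuous_apply x.2).comp (continuous_subtype_val.comp
      ((continuous_apply h).comp (continuous_apply t)))
  have hpath : ∀ t h, Continuous fun τ : BobStrategy m n => pathProb σ τ t h := by
    intro t
    induction t with
    | zero => exact fun h => continuous_const
    | succ t ih => exact fun h => (ih _).mul (hstage _ _ _)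
  simp_rw [expectedLoss_eq_tsum hβ hr]
  refine continuous_tsum (fun t => continuous_const.mul
    (continuous_finsetSum _ fun h _ => (hpath _ h).mul continuous_const))
    ((summable_geometric_of_lt_one hβ.1 hβ.2).mul_right (1 - β)) fun t τ => ?_
  have hm := stageMean_mem hr σ τ k t
  rw [Real.norm_eq_abs, abs_of_nonneg (mul_nonneg (pow_nonneg hβ.1 t) hm.1)]
  exact mul_le_mul_of_nonneg_left hm.2 (pow_nonneg hβ.1 t)

/-- Bob's strategy space is a product of simplices, compact by Tychonoff. -/
lemma exists_bestResponse (hn : 0 < n) (hβ : β ∈ Set.Ico (0 : ℝ) 1)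
    (hr : ∀ a b k, r a b k ∈ Set.Icc (0 : ℝ) (1 - β)) (σ : AliceStrategy m n) (k : Fin K) :
    ∃ τ : BobStrategy m n, ∀ τ', expectedLoss β r σ τ' k ≤ expectedLoss β r σ τ k := by
  have : Nonempty (BobStrategy m n) :=
    ⟨fun _ _ => ⟨Pi.single ⟨0, hn⟩ 1, single_mem_stdSimplex ℝ _⟩⟩
  obtain ⟨τ, -, hτ⟩ := isCompact_univ.exists_isMaxOn Set.univ_nonempty
    (continuous_expectedLoss hβ hr σ k).continuousOn
  exact ⟨τ, fun τ' => hτ (Set.mem_univ τ')⟩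

end Loss

/-! ## Pareto frontiers and upsets -/

section Frontier

variable {K : ℕ} {S V : Set (Fin K → ℝ)}

lemma mem_paretoFrontier_iff {x : Fin K → ℝ} :
    x ∈ paretoFrontier S ↔ x ∈ S ∧ ∀ y ∈ S, y ≤ x → y = x := by
  refine and_congr_right fun _ => forall_congr' fun y => ?_
  constructor
  · intro h hy hle
    by_contra hne
    obtain ⟨k, hk⟩ := h ⟨hy, hne⟩
    exact absurd (hle k) (not_le.mpr hk)
  · rintro h ⟨hy, hne⟩
    by_contra! H
    exact hne (h hy H)

lemma subset_upset (hS : S ⊆ Set.Icc 0 1) : S ⊆ upset S :=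
  fun x hx => ⟨hS hx, x, hx, le_rfl⟩

lemma paretoFrontier_upset (hS : S ⊆ Set.Icc 0 1) :
    paretoFrontier (upset S) = paretoFrontier S := by
  ext x
  simp only [mem_paretoFrontier_iff]
  constructor
  · rintro ⟨⟨_, y, hy, hyx⟩, hmin⟩
    obtain rfl := hmin y (subset_upset hS hy) hyx
    exact ⟨hy, fun z hz => hmin z (subset_upset hS hz)⟩
  · rintro ⟨hx, hmin⟩
    refine ⟨subset_upset hS hx, fun z ⟨_, y, hy, hyz⟩ hzx => ?_⟩
    exact le_antisymm hzx (hmin y hy (hyz.trans hzx) ▸ hyz)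

/-- Below any point of the upset, minimizing the coordinate sum over a compact set yields a
Pareto-minimal point. -/
lemma upset_paretoFrontier (hS : S ⊆ Set.Icc 0 1) (hc : IsClosed (upset S)) :
    upset (paretoFrontier S) = upset S := by
  refine Set.Subset.antisymm (fun x ⟨hx, y, hy, hyx⟩ => ⟨hx, y, hy.1, hyx⟩) fun x hx => ?_
  have hcomp : IsCompact (upset S ∩ Set.Iic x) :=
    (isCompact_Icc.of_isClosed_subset hc fun _ h => h.1).inter_right isClosed_Iic
  obtain ⟨y, ⟨hyU, hyx⟩, hmin⟩ := hcomp.exists_isMinOn ⟨x, hx, Set.mem_Iic.mpr le_rfl⟩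
    (f := fun z : Fin K → ℝ => ∑ k, z k)
    (continuous_finsetSum _ fun k _ => continuous_apply k).continuousOn
  refine ⟨hx.1, y, ?_, hyx⟩
  rw [← paretoFrontier_upset hS, mem_paretoFrontier_iff]
  refine ⟨hyU, fun z hz hzy => ?_⟩
  have hsum : ∑ k, y k ≤ ∑ k, z k := hmin ⟨hz, hzy.trans hyx⟩
  have heq := (Finset.sum_eq_sum_iff_of_le fun k _ => hzy k).mp
    (le_antisymm (Finset.sum_le_sum fun k _ => hzy k) hsum)
  exact funext fun k => heq k (Finset.mem_univ k)

lemma paretoFrontier_eq_self (hV : ∀ u ∈ V, ∀ v ∈ V, u ≤ v → u = v) : paretoFrontier V = V := by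
  ext x
  rw [mem_paretoFrontier_iff]
  exact ⟨fun h => h.1, fun hx => ⟨hx, fun y hy hyx => hV y hy x hx hyx⟩⟩

end Frontier

/-! ## The dynamic programming operator on upsets -/

/-- The points of `[0,1]^K` that Alice can secure in one stage, when the points of `U` are
available as continuations. -/
def stepUpset {m n K : ℕ} (β : ℝ) (r : Fin m → Fin n → Fin K → ℝ) (U : Set (Fin K → ℝ)) :
    Set (Fin K → ℝ) :=
  {x | x ∈ Set.Icc 0 1 ∧ ∃ α ∈ stdSimplex ℝ (Fin m), ∃ R : Fin m → Fin n → Fin K → ℝ,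
    (∀ a b, R a b ∈ U) ∧ ∀ b k, ∑ a, α a * (r a b k + β * R a b k) ≤ x k}

/-- The points of `[0,1]^K` that Alice can secure in the infinitely repeated game. -/
def secured {m n K : ℕ} (β : ℝ) (r : Fin m → Fin n → Fin K → ℝ) : Set (Fin K → ℝ) :=
  {x | x ∈ Set.Icc 0 1 ∧ ∃ σ : AliceStrategy m n, ∀ (τ : BobStrategy m n) (k : Fin K),
    expectedLoss β r σ τ k ≤ x k}

lemma sum_stdSimplex_mul_le {N : ℕ} {p f : Fin N → ℝ} {c : ℝ} (hp : p ∈ stdSimplex ℝ (Fin N))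
    (h : ∀ i, f i ≤ c) : ∑ i, p i * f i ≤ c :=
  calc ∑ i, p i * f i ≤ ∑ i, p i * c :=
        Finset.sum_le_sum fun i _ => mul_le_mul_of_nonneg_left (h i) (hp.1 i)
    _ = c := by rw [← Finset.sum_mul, hp.2, one_mul]

section Step

variable {m n K : ℕ} {β : ℝ} {r : Fin m → Fin n → Fin K → ℝ} {U V : Set (Fin K → ℝ)}

lemma stage_cost_mem (hβ : β ∈ Set.Ico (0 : ℝ) 1)
    (hr : ∀ a b k, r a b k ∈ Set.Icc (0 : ℝ) (1 - β)) {α : Fin m → ℝ}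
    (hα : α ∈ stdSimplex ℝ (Fin m)) {R : Fin m → Fin n → Fin K → ℝ}
    (hR : ∀ a b, R a b ∈ Set.Icc 0 1) (b : Fin n) (k : Fin K) :
    ∑ a, α a * (r a b k + β * R a b k) ∈ Set.Icc (0 : ℝ) 1 := by
  constructor
  · exact Finset.sum_nonneg fun a _ => mul_nonneg (hα.1 a)
      (add_nonneg (hr a b k).1 (mul_nonneg hβ.1 ((hR a b).1 k)))
  · refine sum_stdSimplex_mul_le hα fun a => ?_
    have h1 : β * R a b k ≤ β * 1 := mul_le_mul_of_nonneg_left ((hR a b).2 k) hβ.1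
    linarith [(hr a b k).2]

lemma stepUpset_mono (h : U ⊆ V) : stepUpset β r U ⊆ stepUpset β r V :=
  fun _ ⟨hx, α, hα, R, hR, hle⟩ => ⟨hx, α, hα, R, fun a b => h (hR a b), hle⟩

lemma stepUpset_upper {x y : Fin K → ℝ} (hx : x ∈ stepUpset β r U) (hy : y ∈ Set.Icc 0 1)
    (hxy : x ≤ y) : y ∈ stepUpset β r U := by
  obtain ⟨_, α, hα, R, hR, hle⟩ := hx
  exact ⟨hy, α, hα, R, hR, fun b k => (hle b k).trans (hxy k)⟩

lemma convex_stepUpset (hU : Convex ℝ U) : Convex ℝ (stepUpset β r U) := by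
  rintro x ⟨hx, α, hα, R, hR, hle⟩ y ⟨hy, α', hα', R', hR', hle'⟩ p q hp hq hpq
  -- The mixing weights of `R` and `R'` depend on `a`, being proportional to `p * α a` and `q * α'
  -- a`; this form of convexity also covers both weights being zero.
  choose Q hQ hQeq using fun a b => hU.exists_mem_add_smul_eq (hR a b) (hR' a b)
    (mul_nonneg hp (hα.1 a)) (mul_nonneg hq (hα'.1 a))
  refine ⟨convex_Icc 0 1 hx hy hp hq hpq, p • α + q • α',
    convex_stdSimplex ℝ _ hα hα' hp hq hpq, Q, hQ, fun b k => ?_⟩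
  have hterm : ∀ a, (p • α + q • α') a * (r a b k + β * Q a b k) =
      p * (α a * (r a b k + β * R a b k)) + q * (α' a * (r a b k + β * R' a b k)) := fun a => by
    have := congrFun (hQeq a b) k
    simp only [Pi.add_apply, Pi.smul_apply, smul_eq_mul] at this ⊢
    linear_combination β * this
  simp_rw [hterm]
  rw [Finset.sum_add_distrib, ← Finset.mul_sum, ← Finset.mul_sum]
  exact add_le_add (mul_le_mul_of_nonneg_left (hle b k) hp)
    (mul_le_mul_of_nonneg_left (hle' b k) hq)

/-- It is the projection of a compact set of triples `(x, α, R)`. -/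
lemma isClosed_stepUpset (hU : IsCompact U) : IsClosed (stepUpset β r U) := by
  let C : Set ((Fin K → ℝ) × (Fin m → ℝ) × (Fin m → Fin n → Fin K → ℝ)) :=
    (Set.Icc 0 1 ×ˢ stdSimplex ℝ (Fin m) ×ˢ
      Set.pi Set.univ fun _ => Set.pi Set.univ fun _ => U) ∩
    {z | ∀ b k, ∑ a, z.2.1 a * (r a b k + β * z.2.2 a b k) ≤ z.1 k}
  have hC : IsCompact C := by
    refine (isCompact_Icc.prod ((isCompact_stdSimplex ℝ _).prod
      (isCompact_univ_pi fun _ => isCompact_univ_pi fun _ => hU))).inter_right ?_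
    simp only [Set.ofPred_forall]
    exact isClosed_iInter fun b => isClosed_iInter fun k =>
      isClosed_le (by fun_prop) (by fun_prop)
  convert (hC.image continuous_fst).isClosed using 1
  ext x
  constructor
  · rintro ⟨hx, α, hα, R, hR, hle⟩
    exact ⟨(x, α, R), ⟨⟨hx, hα, fun a _ b _ => hR a b⟩, hle⟩, rfl⟩
  · rintro ⟨⟨x, α, R⟩, ⟨⟨hx, hα, hR⟩, hle⟩, rfl⟩
    exact ⟨hx, α, hα, R, fun a b => hR a trivial b trivial, hle⟩

lemma preOperator_subset (hβ : β ∈ Set.Ico (0 : ℝ) 1)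
    (hr : ∀ a b k, r a b k ∈ Set.Icc (0 : ℝ) (1 - β)) (hV : V ⊆ Set.Icc 0 1) :
    preOperator β r V ⊆ Set.Icc 0 1 := by
  rintro u ⟨α, hα, R, hR, hu⟩
  have h : ∀ k, u k ∈ Set.Icc (0 : ℝ) 1 := fun k => by
    obtain ⟨b, hb⟩ := (hu k).1
    rw [← hb]
    exact stage_cost_mem hβ hr hα (fun a b => hV (hR a b)) b k
  exact ⟨fun k => (h k).1, fun k => (h k).2⟩

lemma upset_preOperator (hn : 0 < n) (hβ : β ∈ Set.Ico (0 : ℝ) 1) (hV : V ⊆ Set.Icc 0 1) :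
    upset (preOperator β r V) = stepUpset β r (upset V) := by
  have : Nonempty (Fin n) := ⟨⟨0, hn⟩⟩
  ext x
  constructor
  · rintro ⟨hx, u, ⟨α, hα, R, hR, hu⟩, hux⟩
    exact ⟨hx, α, hα, R, fun a b => subset_upset hV (hR a b),
      fun b k => ((hu k).2 ⟨b, rfl⟩).trans (hux k)⟩
  · rintro ⟨hx, α, hα, R, hR, hle⟩
    -- Replacing each continuation by a point of `V` below it only lowers the costs.
    choose R' hR' hR'le using fun a b => (hR a b).2
    choose b hb using fun k : Fin K =>
      Finite.exists_max fun b : Fin n => ∑ a, α a * (r a b k + β * R' a b k)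
    refine ⟨hx, fun k => ∑ a, α a * (r a (b k) k + β * R' a (b k) k),
      ⟨α, hα, R', hR', fun k => ⟨⟨b k, rfl⟩, ?_⟩⟩, fun k => ?_⟩
    · rintro _ ⟨b', rfl⟩
      exact hb k b'
    · refine (Finset.sum_le_sum fun a _ => ?_).trans (hle (b k) k)
      exact mul_le_mul_of_nonneg_left
        (add_le_add_right (mul_le_mul_of_nonneg_left (hR'le a (b k) k) hβ.1) _) (hα.1 a)

end Step

/-! ## The secured set as the greatest fixed point -/

/-- The strategy with state space `S` and initial state `s`: mix according to `α s` in state `s` and move to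
the state `next s x` after `x` was played. -/
def stateStrategy {m n : ℕ} {S : Type*} (α : S → stdSimplex ℝ (Fin m))
    (next : S → Fin m × Fin n → S) (s : S) : AliceStrategy m n
  | 0, _ => α s
  | t + 1, h => stateStrategy α next (next s (h 0)) t (Fin.tail h)

section Secured

variable {m n K : ℕ} {β : ℝ} {r : Fin m → Fin n → Fin K → ℝ} {U V : Set (Fin K → ℝ)}

lemma subset_secured (hβ : β ∈ Set.Ico (0 : ℝ) 1)
    (hr : ∀ a b k, r a b k ∈ Set.Icc (0 : ℝ) (1 - β)) (hU : U ⊆ stepUpset β r U) :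
    U ⊆ secured β r := by
  choose α hα R hR hle using fun x : U => (hU x.2).2
  let σ : U → AliceStrategy m n :=
    stateStrategy (fun x => ⟨α x, hα x⟩) fun x ab => ⟨R x ab.1 ab.2, hR x ab.1 ab.2⟩
  -- Keeping promises for `t` stages leaves an error of at most `β ^ t`, since the remaining loss is
  -- at most 1.
  have key : ∀ (t : ℕ) (x : U) (τ : BobStrategy m n) (k : Fin K),
      expectedLoss β r (σ x) τ k ≤ x.1 k + β ^ t := by
    intro t
    induction t with
    | zero =>
      intro x τ k
      have h1 := (expectedLoss_mem hβ hr (σ x) τ k).2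
      have h2 : 0 ≤ x.1 k := (hU x.2).1.1 k
      rw [pow_zero]
      linarith
    | succ t ih =>
      intro x τ k
      rw [expectedLoss_eq_sum hβ hr]
      refine sum_stdSimplex_mul_le (τ 0 Fin.elim0).2 fun b => ?_
      calc ∑ a, α x a * (r a b k +
            β * expectedLoss β r (continuation (σ x) (a, b)) (continuation τ (a, b)) k)
          ≤ ∑ a, (α x a * (r a b k + β * R x a b k) + α x a * β ^ (t + 1)) := by
            refine Finset.sum_le_sum fun a _ => ?_
            rw [← mul_add]
            refine mul_le_mul_of_nonneg_left ?_ ((hα x).1 a)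
            have h := mul_le_mul_of_nonneg_left
              (ih ⟨R x a b, hR x a b⟩ (continuation τ (a, b)) k) hβ.1
            have h' : continuation (σ x) (a, b) = σ ⟨R x a b, hR x a b⟩ := rfl
            rw [h', pow_succ']
            linarith
        _ ≤ x.1 k + β ^ (t + 1) := by
            rw [Finset.sum_add_distrib, ← Finset.sum_mul, (hα x).2, one_mul]
            exact add_le_add_left (hle x b k) _
  intro x hx
  refine ⟨(hU hx).1, σ ⟨x, hx⟩, fun τ k => ?_⟩
  have hlim : Filter.Tendsto (fun t : ℕ => x k + β ^ t) Filter.atTop (nhds (x k + 0)) :=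
    tendsto_const_nhds.add (tendsto_pow_atTop_nhds_zero_of_lt_one hβ.1 hβ.2)
  rw [add_zero] at hlim
  exact ge_of_tendsto' hlim fun t => key t ⟨x, hx⟩ τ k

lemma secured_subset_stepUpset (hn : 0 < n) (hβ : β ∈ Set.Ico (0 : ℝ) 1)
    (hr : ∀ a b k, r a b k ∈ Set.Icc (0 : ℝ) (1 - β)) :
    secured β r ⊆ stepUpset β r (secured β r) := by
  rintro x ⟨hx, σ, hσ⟩
  choose τ hτ using fun (ab : Fin m × Fin n) (k : Fin K) =>
    exists_bestResponse hn hβ hr (continuation σ ab) k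
  have hmem := fun (a : Fin m) (b : Fin n) k =>
    expectedLoss_mem hβ hr (continuation σ (a, b)) (τ (a, b) k) k
  -- The promise after `(a, b)` collects the best-response losses, with a different response of Bob
  -- for each component.
  refine ⟨hx, σ 0 Fin.elim0, (σ 0 Fin.elim0).2, fun a b k =>
    expectedLoss β r (continuation σ (a, b)) (τ (a, b) k) k, fun a b =>
    ⟨⟨fun k => (hmem a b k).1, fun k => (hmem a b k).2⟩, continuation σ (a, b), fun τ' k =>
      hτ (a, b) k τ'⟩, fun b k => ?_⟩
  let e : stdSimplex ℝ (Fin n) := ⟨Pi.single b 1, single_mem_stdSimplex ℝ b⟩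
  -- Against Bob playing `b` surely and then best responding for component `k`, the loss is exactly
  -- the stage cost at `b`.
  refine le_of_eq_of_le ?_ (hσ (prepend e fun ab => τ ab k) k)
  rw [expectedLoss_eq_sum hβ hr, Finset.sum_eq_single b]
  · have he : prepend e (fun ab => τ ab k) 0 Fin.elim0 b = (1 : ℝ) := Pi.single_eq_same b 1
    rw [he, one_mul]
    rfl
  · intro b' _ hb'
    have he : prepend e (fun ab => τ ab k) 0 Fin.elim0 b' = (0 : ℝ) :=
      Pi.single_eq_of_ne hb' 1
    rw [he, zero_mul]
  · exact fun h => absurd (Finset.mem_univ b) h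

lemma stepUpset_secured (hn : 0 < n) (hβ : β ∈ Set.Ico (0 : ℝ) 1)
    (hr : ∀ a b k, r a b k ∈ Set.Icc (0 : ℝ) (1 - β)) :
    stepUpset β r (secured β r) = secured β r :=
  have h := secured_subset_stepUpset hn hβ hr
  (subset_secured hβ hr (stepUpset_mono h)).antisymm h

lemma secured_subset_Icc : secured β r ⊆ Set.Icc 0 1 := fun _ hx => hx.1

lemma one_mem_secured (hm : 0 < m) (hβ : β ∈ Set.Ico (0 : ℝ) 1)
    (hr : ∀ a b k, r a b k ∈ Set.Icc (0 : ℝ) (1 - β)) : (1 : Fin K → ℝ) ∈ secured β r :=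
  ⟨⟨zero_le_one, le_rfl⟩, fun _ _ => ⟨Pi.single ⟨0, hm⟩ 1, single_mem_stdSimplex ℝ _⟩,
    fun τ k => (expectedLoss_mem hβ hr _ τ k).2⟩

/-- The closure satisfies the coinduction hypothesis, as `stepUpset` of a compact set is closed. -/
lemma isClosed_secured (hn : 0 < n) (hβ : β ∈ Set.Ico (0 : ℝ) 1)
    (hr : ∀ a b k, r a b k ∈ Set.Icc (0 : ℝ) (1 - β)) : IsClosed (secured β r) := by
  have hcomp : IsCompact (closure (secured β r)) :=
    isCompact_Icc.of_isClosed_subset isClosed_closure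
      (closure_minimal secured_subset_Icc isClosed_Icc)
  refine closure_subset_iff_isClosed.mp (subset_secured hβ hr ?_)
  refine closure_minimal ?_ (isClosed_stepUpset hcomp)
  exact (secured_subset_stepUpset hn hβ hr).trans (stepUpset_mono subset_closure)

lemma convex_secured (hn : 0 < n) (hβ : β ∈ Set.Ico (0 : ℝ) 1)
    (hr : ∀ a b k, r a b k ∈ Set.Icc (0 : ℝ) (1 - β)) : Convex ℝ (secured β r) := by
  have h : convexHull ℝ (secured β r) ⊆ secured β r := by
    refine subset_secured hβ hr (convexHull_min ?_ (convex_stepUpset (convex_convexHull ℝ _)))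
    exact (secured_subset_stepUpset hn hβ hr).trans (stepUpset_mono (subset_convexHull ℝ _))
  rw [← h.antisymm (subset_convexHull ℝ _)]
  exact convex_convexHull ℝ _

lemma eq_secured_of_stepUpset_eq (hn : 0 < n) (hβ : β ∈ Set.Ico (0 : ℝ) 1)
    (hr : ∀ a b k, r a b k ∈ Set.Icc (0 : ℝ) (1 - β)) (hne : U.Nonempty) (hc : IsClosed U)
    (hU : stepUpset β r U = U) : U = secured β r := by
  have hupper : ∀ {x y}, x ∈ U → y ∈ Set.Icc 0 1 → x ≤ y → y ∈ U := fun hx hy hxy => by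
    rw [← hU] at hx ⊢
    exact stepUpset_upper hx hy hxy
  have hUI : U ⊆ Set.Icc 0 1 := hU ▸ fun _ h => h.1
  have hcube : ∀ x ∈ secured β r, ∀ t : ℕ, (fun k => min (x k + β ^ t) 1) ∈ Set.Icc 0 1 :=
    fun x hx t => ⟨fun k => le_min (add_nonneg (hx.1.1 k) (pow_nonneg hβ.1 t)) zero_le_one,
      fun k => min_le_right _ _⟩
  -- For `t = 0` the capped vector is constantly 1, the top of the cube. In the inductive step the
  -- continuations are the capped shifts of `R a b`, and the factor `β` turns their error `β ^ t`
  -- into `β ^ (t + 1)`.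
  have key : ∀ (t : ℕ), ∀ x ∈ secured β r, (fun k => min (x k + β ^ t) 1) ∈ U := by
    intro t
    induction t with
    | zero =>
      intro x hx
      obtain ⟨y, hy⟩ := hne
      refine hupper hy (hcube x hx 0) fun k => le_min ?_ ((hUI hy).2 k)
      have h1 : y k ≤ 1 := (hUI hy).2 k
      have h2 : 0 ≤ x k := hx.1.1 k
      rw [pow_zero]
      linarith
    | succ t ih =>
      intro x hx
      obtain ⟨-, α, hα, R, hR, hle⟩ := secured_subset_stepUpset hn hβ hr hx
      have hR' := fun a b => ih (R a b) (hR a b)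
      rw [← hU]
      refine ⟨hcube x hx _, α, hα, _, hR', fun b k => le_min ?_
        (stage_cost_mem hβ hr hα (fun a b => hUI (hR' a b)) b k).2⟩
      calc ∑ a, α a * (r a b k + β * min (R a b k + β ^ t) 1)
          ≤ ∑ a, (α a * (r a b k + β * R a b k) + α a * β ^ (t + 1)) := by
            refine Finset.sum_le_sum fun a _ => ?_
            rw [← mul_add]
            refine mul_le_mul_of_nonneg_left ?_ (hα.1 a)
            have h := mul_le_mul_of_nonneg_left (min_le_left (R a b k + β ^ t) 1) hβ.1
            rw [pow_succ']
            linarith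
        _ ≤ x k + β ^ (t + 1) := by
            rw [Finset.sum_add_distrib, ← Finset.sum_mul, hα.2, one_mul]
            exact add_le_add_left (hle b k) _
  refine (subset_secured hβ hr hU.ge).antisymm fun x hx => ?_
  refine hc.mem_of_tendsto (f := fun t : ℕ => fun k => min (x k + β ^ t) 1) (b := Filter.atTop)
    (tendsto_pi_nhds.mpr fun k => ?_) (Filter.Eventually.of_forall fun t => key t x hx)
  have hlim : Filter.Tendsto (fun t : ℕ => min (x k + β ^ t) 1) Filter.atTop
      (nhds (min (x k + 0) 1)) :=
    (tendsto_const_nhds.add (tendsto_pow_atTop_nhds_zero_of_lt_one hβ.1 hβ.2)).min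
      tendsto_const_nhds
  have hx1 : x k ≤ 1 := hx.1.2 k
  rwa [add_zero, min_eq_left hx1] at hlim

/-! ### From the secured set back to frontiers -/

lemma guarantees_subset (hβ : β ∈ Set.Ico (0 : ℝ) 1)
    (hr : ∀ a b k, r a b k ∈ Set.Icc (0 : ℝ) (1 - β)) : guarantees β r ⊆ Set.Icc 0 1 := by
  rintro w ⟨σ, hw⟩
  have h : ∀ k, w k ∈ Set.Icc (0 : ℝ) 1 := fun k => by
    obtain ⟨τ, hτ⟩ := (hw k).1
    rw [← hτ]
    exact expectedLoss_mem hβ hr σ τ k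
  exact ⟨fun k => (h k).1, fun k => (h k).2⟩

/-- Best responses turn an upper bound into a vector of attained maxima below it. -/
lemma upset_guarantees (hn : 0 < n) (hβ : β ∈ Set.Ico (0 : ℝ) 1)
    (hr : ∀ a b k, r a b k ∈ Set.Icc (0 : ℝ) (1 - β)) :
    upset (guarantees β r) = secured β r := by
  ext x
  constructor
  · rintro ⟨hx, w, ⟨σ, hw⟩, hwx⟩
    exact ⟨hx, σ, fun τ k => ((hw k).2 ⟨τ, rfl⟩).trans (hwx k)⟩
  · rintro ⟨hx, σ, hσ⟩
    choose τ hτ using fun k : Fin K => exists_bestResponse hn hβ hr σ k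
    refine ⟨hx, fun k => expectedLoss β r σ (τ k) k, ⟨σ, fun k => ⟨⟨τ k, rfl⟩, ?_⟩⟩,
      fun k => hσ (τ k) k⟩
    rintro _ ⟨τ', rfl⟩
    exact hτ k τ'

lemma upset_optimalFrontier (hn : 0 < n) (hβ : β ∈ Set.Ico (0 : ℝ) 1)
    (hr : ∀ a b k, r a b k ∈ Set.Icc (0 : ℝ) (1 - β)) :
    upset (optimalFrontier β r) = secured β r := by
  have h := upset_guarantees hn hβ hr
  rw [optimalFrontier, upset_paretoFrontier (guarantees_subset hβ hr), h]
  rw [h]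
  exact isClosed_secured hn hβ hr

lemma optimalFrontier_eq (hn : 0 < n) (hβ : β ∈ Set.Ico (0 : ℝ) 1)
    (hr : ∀ a b k, r a b k ∈ Set.Icc (0 : ℝ) (1 - β)) :
    optimalFrontier β r = paretoFrontier (secured β r) := by
  rw [← upset_guarantees hn hβ hr, paretoFrontier_upset (guarantees_subset hβ hr),
    optimalFrontier]

lemma optimalFrontier_mem_frontierSpace (hm : 0 < m) (hn : 0 < n) (hβ : β ∈ Set.Ico (0 : ℝ) 1)
    (hr : ∀ a b k, r a b k ∈ Set.Icc (0 : ℝ) (1 - β)) :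
    optimalFrontier β r ∈ frontierSpace K := by
  have hup := upset_optimalFrontier hn hβ hr
  refine ⟨?_, fun x hx => guarantees_subset hβ hr hx.1, fun u hu v hv huv =>
    (mem_paretoFrontier_iff.mp hv).2 u hu.1 huv, ?_, ?_⟩
  · obtain ⟨-, y, hy, -⟩ := hup.ge (one_mem_secured hm hβ hr)
    exact ⟨y, hy⟩
  · rw [hup]
    exact isClosed_secured hn hβ hr
  · rw [hup]
    exact convex_secured hn hβ hr

lemma dpOperator_eq (hn : 0 < n) (hβ : β ∈ Set.Ico (0 : ℝ) 1)
    (hr : ∀ a b k, r a b k ∈ Set.Icc (0 : ℝ) (1 - β)) (hV : V ⊆ Set.Icc 0 1) :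
    dpOperator β r V = paretoFrontier (stepUpset β r (upset V)) := by
  rw [← upset_preOperator hn hβ hV, paretoFrontier_upset (preOperator_subset hβ hr hV),
    dpOperator]

lemma upset_dpOperator (hn : 0 < n) (hβ : β ∈ Set.Ico (0 : ℝ) 1)
    (hr : ∀ a b k, r a b k ∈ Set.Icc (0 : ℝ) (1 - β)) (hV : V ⊆ Set.Icc 0 1)
    (hc : IsClosed (upset V)) :
    upset (dpOperator β r V) = stepUpset β r (upset V) := by
  have h := upset_preOperator (r := r) hn hβ hV
  rw [dpOperator, upset_paretoFrontier (preOperator_subset hβ hr hV), h]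
  rw [h]
  exact isClosed_stepUpset (isCompact_Icc.of_isClosed_subset hc fun _ hx => hx.1)

end Secured

end VectorGame

theorem theorem2 {m n K : ℕ} (hm : 0 < m) (hn : 0 < n) (β : ℝ) (hβ : β ∈ Set.Ico (0 : ℝ) 1)
    (r : Fin m → Fin n → Fin K → ℝ) (hr : ∀ a b k, r a b k ∈ Set.Icc (0 : ℝ) (1 - β)) :
    (VectorGame.optimalFrontier β r ∈ VectorGame.frontierSpace K ∧
      VectorGame.dpOperator β r (VectorGame.optimalFrontier β r) =
        VectorGame.optimalFrontier β r) ∧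
    ∀ V ∈ VectorGame.frontierSpace K,
      VectorGame.dpOperator β r V = V → V = VectorGame.optimalFrontier β r := by
  have hmem := VectorGame.optimalFrontier_mem_frontierSpace hm hn hβ hr
  refine ⟨⟨hmem, ?_⟩, ?_⟩
  · rw [VectorGame.dpOperator_eq hn hβ hr hmem.2.1, VectorGame.upset_optimalFrontier hn hβ hr,
      VectorGame.stepUpset_secured hn hβ hr, VectorGame.optimalFrontier_eq hn hβ hr]
  · rintro V ⟨hne, hV, hanti, hclosed, -⟩ hfix
    have hstep := VectorGame.upset_dpOperator hn hβ hr hV hclosed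
    rw [hfix] at hstep
    -- The upset of `V` is the secured set, and `V` is recovered as its minimal points because it is
    -- an antichain.
    have hU := VectorGame.eq_secured_of_stepUpset_eq hn hβ hr
      (hne.mono (VectorGame.subset_upset hV)) hclosed hstep.symm
    rw [VectorGame.optimalFrontier_eq hn hβ hr, ← hU, VectorGame.paretoFrontier_upset hV,
      VectorGame.paretoFrontier_eq_self hanti]
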